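/- Let $f:\mathbb{N}_{\ge 1}\to\mathbb{R}$ be a real additive arithmetic function, i.e. $f(1)=0$ and $f(mn)=f(m)+f(n)$ whenever $\gcd(m,n)=1$. Suppose that for every real $t$ $$\sum_{p}\sum_{\alpha\ge 1}\frac{\left|e^{itf(p^\alpha)}-e^{itf(p^{\alpha-1})}\right|}{p^\alpha}<\infty ,$$ where $p$ runs over the primes. Then $f$ has a limit distribution: there is a probability distribution function $F$ on $\mathbb{R}$ such that $$F_n(y)=\frac1n\,\#\{1\le m\le n:\ f(m)\le y\}\ \longrightarrow\ F(y)\qquad(n\to\infty)$$ at every continuity point $y$ of $F$. Moreover, for every real $t$, the characteristic function $\varphi_f(t)=\int_{\mathbb{R}}e^{itx}\,dF(x)$ of this limit distribution is $$\varphi_f(t)=\prod_p\left(1-\frac1p\right)\sum_{\alpha\ge 0}\frac{e^{itf(p^\alpha)}}{p^\alpha},$$ where the product over primes converges unconditionally (as the limit of its finite partial products; the value $0$ is allowed). -/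

import Mathlib

open Filter Topology MeasureTheory ProbabilityTheory

/-- A real arithmetic function is additive if `f 1 = 0` and `f (m * n) = f m + f n` for
coprime `m`, `n`. (The value at `0` plays no role.) -/
def IsAdditiveArith (f : ArithmeticFunction ℝ) : Prop :=
  f 1 = 0 ∧ ∀ m n : ℕ, Nat.Coprime m n → f (m * n) = f m + f n

/-- The distribution function `F_n(y) = #{m ≤ n : f(m) ≤ y} / n` of `f` on `{1, …, n}` with the
uniform probability. -/
noncomputable def empiricalCDF (f : ArithmeticFunction ℝ) (n : ℕ) (y : ℝ) : ℝ :=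
  (((Finset.Icc 1 n).filter (fun m => f m ≤ y)).card : ℝ) / (n : ℝ)

/-- `μ` is the limit distribution of `f`: it is a probability measure on the line, and the
distribution functions `F_n` converge weakly to that of `μ`, i.e. at each of its continuity
points. -/
def HasLimitDistribution (f : ArithmeticFunction ℝ) (μ : Measure ℝ) : Prop :=
  IsProbabilityMeasure μ ∧
    ∀ y : ℝ, ContinuousAt (cdf μ) y →
      Tendsto (fun n : ℕ => empiricalCDF f n y) atTop (𝓝 (cdf μ y))

/-- `e^{i t f(n)}`. -/
noncomputable def expTwist (f : ArithmeticFunction ℝ) (t : ℝ) (n : ℕ) : ℂ :=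
  Complex.exp (Complex.I * (t : ℂ) * ((f n : ℝ) : ℂ))

/-- The local factor `(1 - 1/p) ∑_{α ≥ 0} e^{i t f(p^α)} / p^α`. For a prime `p` the series is
dominated by a convergent geometric series. -/
noncomputable def localFactor (f : ArithmeticFunction ℝ) (t : ℝ) (p : ℕ) : ℂ :=
  (1 - 1 / (p : ℂ)) * ∑' α : ℕ, expTwist f t (p ^ α) / (p : ℂ) ^ α

/-!
Fix `t` and put `g = e^{itf}`, a multiplicative function, and `h = g * μ`, so that `g = h * ζ` and
`h(p^α) = e^{itf(p^α)} - e^{itf(p^{α-1})}`. The hypothesis bounds `∑ |h(p^α)| / p^α` over the prime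
powers by some `S(t) < ∞`; hence `∑ |h(n)| / n ≤ exp S(t)`, and by Wintner's theorem `g` has the
mean value `φ(t) = ∑ h(n) / n`, whose Euler factors are the local factors.

By Lévy's theorem it remains to see that `φ` is continuous at `0`. As `|φ(t) - 1| ≤ exp S(t) - 1`,
it is enough that `S(t) → 0` as `t → 0`. No uniformity in `t` is assumed, but `S` is a countable sum
of continuous group seminorms on `ℝ` which is finite everywhere, and Baire's theorem makes its tails
small near some point, hence, by subadditivity, near `0`.
-/

section SumOfSeminorms

lemma isClosed_setOf_tsum_le {ι X : Type*} [TopologicalSpace X] {φ : ι → X → ℝ}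
    (hφ : ∀ i, Continuous (φ i)) (hnonneg : ∀ i x, 0 ≤ φ i x)
    (hsum : ∀ x, Summable fun i => φ i x) (M : ℝ) : IsClosed {x | ∑' i, φ i x ≤ M} := by
  have h_eq : {x | ∑' i, φ i x ≤ M} = ⋂ F : Finset ι, {x | ∑ i ∈ F, φ i x ≤ M} := by
    ext x
    simp only [Set.mem_ofPred_eq, Set.mem_iInter]
    exact ⟨fun h F => ((hsum x).sum_le_tsum F fun i _ => hnonneg i x).trans h,
      (hsum x).tsum_le_of_sum_le⟩
  rw [h_eq]
  exact isClosed_iInter fun F => isClosed_le (by fun_prop) continuous_const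

variable {ι G : Type*} [AddGroup G] [TopologicalSpace G] [ContinuousAdd G] [BaireSpace G]
  {p : ι → AddGroupSeminorm G}

lemma exists_finset_eventually_tsum_compl_le [Countable ι] (hp : ∀ i, Continuous (p i))
    (hsum : ∀ x, Summable fun i => p i x) {ε : ℝ} (hε : 0 < ε) :
    ∃ F : Finset ι, ∀ᶠ x in 𝓝 (0 : G), ∑' i : {i // i ∉ F}, p i x ≤ ε := by
  have hsub (F : Finset ι) (x : G) : Summable fun i : {i // i ∉ F} => p i x :=
    (hsum x).subtype _
  -- Baire: some tail is at most `ε / 2` near a point `c`; subadditivity then moves it to `0`.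
  obtain ⟨F, c, hc⟩ := nonempty_interior_of_iUnion_of_closed
    (f := fun F : Finset ι => {x | ∑' i : {i // i ∉ F}, p i x ≤ ε / 2})
    (fun F => isClosed_setOf_tsum_le (φ := fun i : {i // i ∉ F} => p i) (fun i => hp i)
      (fun i => apply_nonneg (p i)) (hsub F) _)
    (Set.eq_univ_of_forall fun x => Set.mem_iUnion.2
      ((tendsto_tsum_compl_atTop_zero fun i => p i x).eventually_le_const (half_pos hε)).exists)
  refine ⟨F, ?_⟩
  have hc_le : ∑' i : {i // i ∉ F}, p i c ≤ ε / 2 :=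
    interior_subset (s := {x | ∑' i : {i // i ∉ F}, p i x ≤ ε / 2}) hc
  have h_translate : Tendsto (fun x : G => x + c) (𝓝 0) (𝓝 c) :=
    (continuous_add_const c).tendsto' 0 c (zero_add c)
  filter_upwards [h_translate.eventually (mem_interior_iff_mem_nhds.1 hc)] with x hx
  calc ∑' i : {i // i ∉ F}, p i x
      ≤ ∑' i : {i // i ∉ F}, (p i (x + c) + p i c) :=
        (hsub F x).tsum_le_tsum
          (fun i => by simpa only [add_sub_cancel_right] using map_sub_le_add (p i) (x + c) c)
          ((hsub F (x + c)).add (hsub F c))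
    _ = ∑' i : {i // i ∉ F}, p i (x + c) + ∑' i : {i // i ∉ F}, p i c :=
        (hsub F (x + c)).tsum_add (hsub F c)
    _ ≤ ε / 2 + ε / 2 := add_le_add hx hc_le
    _ = ε := add_halves ε

lemma tendsto_tsum_addGroupSeminorm_nhds_zero [Countable ι] (hp : ∀ i, Continuous (p i))
    (hsum : ∀ x, Summable fun i => p i x) :
    Tendsto (fun x => ∑' i, p i x) (𝓝 0) (𝓝 0) := by
  refine tendsto_order.2 ⟨fun a ha => .of_forall fun x => ha.trans_le
    (tsum_nonneg fun i => apply_nonneg (p i) x), fun ε hε => ?_⟩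
  obtain ⟨F, h_tail⟩ := exists_finset_eventually_tsum_compl_le hp hsum (half_pos hε)
  have h_head : Tendsto (fun x => ∑ i ∈ F, p i x) (𝓝 0) (𝓝 0) :=
    Continuous.tendsto' (by fun_prop) 0 0 (by simp only [map_zero, Finset.sum_const_zero])
  filter_upwards [h_tail, h_head.eventually_lt_const (half_pos hε)] with x hx_tail hx_head
  rw [← (hsum x).sum_add_tsum_subtype_compl F]
  linarith

end SumOfSeminorms

lemma exists_tendsto_of_tendsto_charFun {E : Type*} [NormedAddCommGroup E] [InnerProductSpace ℝ E]
    [FiniteDimensional ℝ E] [MeasurableSpace E] [BorelSpace E] {μ : ℕ → ProbabilityMeasure E}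
    {φ : E → ℂ} (hφ : ContinuousAt φ 0)
    (h : ∀ t, Tendsto (fun n => charFun (μ n : Measure E) t) atTop (𝓝 (φ t))) :
    ∃ ν : ProbabilityMeasure E, Tendsto μ atTop (𝓝 ν) ∧ charFun (ν : Measure E) = φ := by
  have h_tight : IsTightMeasureSet {(ρ : Measure E) | ρ ∈ Set.range μ} := by
    simp only [Set.exists_range_iff]
    exact isTightMeasureSet_of_tendsto_charFun hφ h
  obtain ⟨ν, -, k, hk, hν⟩ := (isCompact_closure_of_isTightMeasureSet h_tight).tendsto_subseq
    fun n => subset_closure (Set.mem_range_self n)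
  have h_char : charFun (ν : Measure E) = φ := funext fun t => tendsto_nhds_unique
    (ProbabilityMeasure.tendsto_iff_tendsto_charFun.1 hν t) ((h t).comp hk.tendsto_atTop)
  exact ⟨ν, ProbabilityMeasure.tendsto_iff_tendsto_charFun.2 (h_char ▸ h), h_char⟩

lemma measure_singleton_eq_zero_of_continuousAt_cdf {μ : Measure ℝ} [IsProbabilityMeasure μ]
    {y : ℝ} (hy : ContinuousAt (cdf μ) y) : μ {y} = 0 := by
  rw [← measure_cdf μ, StieltjesFunction.measure_singleton,
    hy.continuousWithinAt.leftLim_eq, sub_self, ENNReal.ofReal_zero]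

lemma tendsto_cdf_of_tendsto {ι : Type*} {l : Filter ι} {μ : ι → ProbabilityMeasure ℝ}
    {ν : ProbabilityMeasure ℝ} (h : Tendsto μ l (𝓝 ν)) {y : ℝ}
    (hy : ContinuousAt (cdf (ν : Measure ℝ)) y) :
    Tendsto (fun i => cdf (μ i : Measure ℝ) y) l (𝓝 (cdf (ν : Measure ℝ) y)) := by
  simp only [cdf_eq_real]
  refine (ENNReal.tendsto_toReal (measure_ne_top _ _)).comp
    (ProbabilityMeasure.tendsto_measure_of_null_frontier_of_tendsto' h ?_)
  rw [frontier_Iic, measure_singleton_eq_zero_of_continuousAt_cdf hy]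

section EmpiricalMeasure

/-- The law of the sequence `u` under the uniform probability on `{1, …, n}`; it is `0` for
`n = 0`. -/
noncomputable def empiricalMeasure {α : Type*} [MeasurableSpace α] (u : ℕ → α) (n : ℕ) :
    Measure α :=
  (n : ENNReal)⁻¹ • ∑ m ∈ Finset.Icc 1 n, Measure.dirac (u m)

lemma isProbabilityMeasure_empiricalMeasure {α : Type*} [MeasurableSpace α] (u : ℕ → α) {n : ℕ}
    (hn : n ≠ 0) : IsProbabilityMeasure (empiricalMeasure u n) := by
  constructor
  simp [empiricalMeasure, ENNReal.inv_mul_cancel (Nat.cast_ne_zero.2 hn) (ENNReal.natCast_ne_top n)]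

lemma integral_empiricalMeasure {α E : Type*} [MeasurableSpace α] [MeasurableSingletonClass α]
    [NormedAddCommGroup E] [NormedSpace ℝ E] [CompleteSpace E] (u : ℕ → α) (n : ℕ) (φ : α → E) :
    ∫ x, φ x ∂empiricalMeasure u n = (n : ℝ)⁻¹ • ∑ m ∈ Finset.Icc 1 n, φ (u m) := by
  rw [empiricalMeasure, integral_smul_measure, ENNReal.toReal_inv, ENNReal.toReal_natCast,
    integral_finsetSum_measure fun m _ => integrable_dirac enorm_lt_top]
  simp only [integral_dirac]

lemma charFun_empiricalMeasure (f : ArithmeticFunction ℝ) (n : ℕ) (t : ℝ) :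
    charFun (empiricalMeasure f n) t = (n : ℂ)⁻¹ * ∑ m ∈ Finset.Icc 1 n, expTwist f t m := by
  simp only [charFun_apply_real, integral_empiricalMeasure, Complex.real_smul, Complex.ofReal_inv,
    Complex.ofReal_natCast, expTwist, mul_comm, mul_assoc]

lemma cdf_empiricalMeasure (f : ArithmeticFunction ℝ) {n : ℕ} (hn : n ≠ 0) (y : ℝ) :
    cdf (empiricalMeasure f n) y = empiricalCDF f n y := by
  have := isProbabilityMeasure_empiricalMeasure f hn
  rw [cdf_eq_real, ← integral_indicator_one measurableSet_Iic, integral_empiricalMeasure,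
    empiricalCDF, div_eq_inv_mul, smul_eq_mul]
  simp only [Set.indicator_apply, Set.mem_Iic, Pi.one_apply, Finset.sum_boole]

lemma exists_hasLimitDistribution {f : ArithmeticFunction ℝ} {φ : ℝ → ℂ} (hφ : ContinuousAt φ 0)
    (h : ∀ t, Tendsto (fun n : ℕ => (n : ℂ)⁻¹ * ∑ m ∈ Finset.Icc 1 n, expTwist f t m) atTop
      (𝓝 (φ t))) :
    ∃ μ : Measure ℝ, HasLimitDistribution f μ ∧ charFun μ = φ := by
  let law (n : ℕ) : ProbabilityMeasure ℝ :=
    ⟨empiricalMeasure f (n + 1), isProbabilityMeasure_empiricalMeasure f n.succ_ne_zero⟩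
  have h_charFun (t : ℝ) : Tendsto (fun n => charFun (law n : Measure ℝ) t) atTop (𝓝 (φ t)) :=
    ((tendsto_add_atTop_iff_nat 1).2 (h t)).congr fun n =>
      (charFun_empiricalMeasure f (n + 1) t).symm
  obtain ⟨ν, h_law, hν⟩ := exists_tendsto_of_tendsto_charFun hφ h_charFun
  refine ⟨ν, ⟨inferInstance, fun y hy => (tendsto_add_atTop_iff_nat 1).1 ?_⟩, hν⟩
  exact (tendsto_cdf_of_tendsto h_law hy).congr fun n => cdf_empiricalMeasure f n.succ_ne_zero y

end EmpiricalMeasure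

section MultiplicativeSum

variable {𝕜 : Type*} [NormedField 𝕜] {g : ArithmeticFunction 𝕜}

lemma sum_range_norm_le_prod_primesBelow (hg : g.IsMultiplicative)
    (hsum : ∀ {p : ℕ}, p.Prime → Summable fun k : ℕ => ‖g (p ^ k)‖) (N : ℕ) :
    ∑ n ∈ Finset.range N, ‖g n‖ ≤ ∏ p ∈ N.primesBelow, ∑' k : ℕ, ‖g (p ^ k)‖ := by
  have h_prod : HasSum (N.smoothNumbers.indicator (‖g ·‖))
      (∏ p ∈ N.primesBelow, ∑' k : ℕ, ‖g (p ^ k)‖) :=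
    hasSum_subtype_iff_indicator.1
      (EulerProduct.summable_and_hasSum_smoothNumbers_prod_primesBelow_tsum (f := (‖g ·‖))
        (by rw [hg.map_one, norm_one])
        (fun hmn => by rw [hg.map_mul_of_coprime hmn, norm_mul])
        (fun hp => by simpa only [norm_norm] using hsum hp) N).2
  have h_smooth : ∀ n ∈ Finset.range N, ‖g n‖ = N.smoothNumbers.indicator (‖g ·‖) n := by
    intro n hn
    rcases n.eq_zero_or_pos with rfl | hpos
    · simp [Set.indicator_apply]
    · rw [Set.indicator_of_mem (Nat.mem_smoothNumbers_of_lt hpos (Finset.mem_range.1 hn))]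
  rw [Finset.sum_congr rfl h_smooth]
  exact sum_le_hasSum _ (fun n _ => Set.indicator_nonneg (fun _ _ => norm_nonneg _) n) h_prod

lemma summable_norm_prime_pow (hsum : Summable fun x : Nat.Primes × ℕ => ‖g (x.1 ^ (x.2 + 1))‖)
    {p : ℕ} (hp : p.Prime) : Summable fun k : ℕ => ‖g (p ^ k)‖ :=
  (summable_nat_add_iff 1).1 (hsum.prod_factor ⟨p, hp⟩)

lemma prod_primesBelow_tsum_norm_le_exp (hg : g.IsMultiplicative)
    (hsum : Summable fun x : Nat.Primes × ℕ => ‖g (x.1 ^ (x.2 + 1))‖) (N : ℕ) :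
    ∏ p ∈ N.primesBelow, ∑' k : ℕ, ‖g (p ^ k)‖ ≤
      Real.exp (∑' x : Nat.Primes × ℕ, ‖g (x.1 ^ (x.2 + 1))‖) := by
  have h_split : ∀ p ∈ N.primesBelow,
      ∑' k : ℕ, ‖g (p ^ k)‖ = 1 + ∑' k : ℕ, ‖g (p ^ (k + 1))‖ := fun p hp => by
    rw [(summable_norm_prime_pow hsum (Nat.prime_of_mem_primesBelow hp)).tsum_eq_zero_add,
      pow_zero, hg.map_one, norm_one]
  calc ∏ p ∈ N.primesBelow, ∑' k : ℕ, ‖g (p ^ k)‖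
      = ∏ p ∈ N.primesBelow, (1 + ∑' k : ℕ, ‖g (p ^ (k + 1))‖) := Finset.prod_congr rfl h_split
    _ ≤ Real.exp (∑ p ∈ N.primesBelow, ∑' k : ℕ, ‖g (p ^ (k + 1))‖) :=
        Real.prod_one_add_le_exp_sum _ fun p => tsum_nonneg fun k => norm_nonneg _
    _ ≤ Real.exp (∑' x : Nat.Primes × ℕ, ‖g (x.1 ^ (x.2 + 1))‖) := by
        rw [hsum.tsum_prod, Real.exp_le_exp, ← Finset.sum_subtype_of_mem (p := Nat.Prime) _
          fun p => Nat.prime_of_mem_primesBelow]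
        exact hsum.prod.sum_le_tsum (ι := Nat.Primes) _
          fun p _ => tsum_nonneg fun k => norm_nonneg _

lemma sum_range_norm_le_exp (hg : g.IsMultiplicative)
    (hsum : Summable fun x : Nat.Primes × ℕ => ‖g (x.1 ^ (x.2 + 1))‖) (N : ℕ) :
    ∑ n ∈ Finset.range N, ‖g n‖ ≤ Real.exp (∑' x : Nat.Primes × ℕ, ‖g (x.1 ^ (x.2 + 1))‖) :=
  (sum_range_norm_le_prod_primesBelow hg (summable_norm_prime_pow hsum) N).trans
    (prod_primesBelow_tsum_norm_le_exp hg hsum N)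

lemma summable_norm_of_summable_norm_prime_pow (hg : g.IsMultiplicative)
    (hsum : Summable fun x : Nat.Primes × ℕ => ‖g (x.1 ^ (x.2 + 1))‖) :
    Summable fun n => ‖g n‖ :=
  summable_of_sum_range_le (fun _ => norm_nonneg _) (sum_range_norm_le_exp hg hsum)

lemma norm_tsum_sub_one_le [CompleteSpace 𝕜] (hg : g.IsMultiplicative)
    (hsum : Summable fun x : Nat.Primes × ℕ => ‖g (x.1 ^ (x.2 + 1))‖) :
    ‖∑' n, g n - 1‖ ≤ Real.exp (∑' x : Nat.Primes × ℕ, ‖g (x.1 ^ (x.2 + 1))‖) - 1 := by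
  have hs := summable_norm_of_summable_norm_prime_pow hg hsum
  have h_tail : ∑' n, g n - 1 = ∑' n : {n // n ∉ ({1} : Finset ℕ)}, g n := by
    rw [← hs.of_norm.sum_add_tsum_subtype_compl {1}, Finset.sum_singleton, hg.map_one,
      add_sub_cancel_left]
  have h_norm_tail : ∑' n, ‖g n‖ - 1 = ∑' n : {n // n ∉ ({1} : Finset ℕ)}, ‖g n‖ := by
    rw [← hs.sum_add_tsum_subtype_compl {1}, Finset.sum_singleton, hg.map_one, norm_one,
      add_sub_cancel_left]
  calc ‖∑' n, g n - 1‖ = ‖∑' n : {n // n ∉ ({1} : Finset ℕ)}, g n‖ := by rw [h_tail]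
    _ ≤ ∑' n : {n // n ∉ ({1} : Finset ℕ)}, ‖g n‖ := norm_tsum_le_tsum_norm (hs.subtype _)
    _ = ∑' n, ‖g n‖ - 1 := h_norm_tail.symm
    _ ≤ Real.exp (∑' x : Nat.Primes × ℕ, ‖g (x.1 ^ (x.2 + 1))‖) - 1 := by
        gcongr
        exact Real.tsum_le_of_sum_range_le (fun _ => norm_nonneg _) (sum_range_norm_le_exp hg hsum)

end MultiplicativeSum

section MeanValue

open scoped ArithmeticFunction.zeta ArithmeticFunction.Moebius

variable {𝕜 : Type*} [RCLike 𝕜]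

lemma tendsto_natCast_div_div_atTop (d : ℕ) :
    Tendsto (fun N : ℕ => ((N / d : ℕ) : 𝕜) / N) atTop (𝓝 (d : 𝕜)⁻¹) := by
  have h_real : Tendsto (fun N : ℕ => ((N / d : ℕ) : ℝ) / N) atTop (𝓝 (d : ℝ)⁻¹) := by
    refine ((tendsto_nat_floor_mul_div_atTop (R := ℝ) (a := (d : ℝ)⁻¹) (by positivity)).comp
      tendsto_natCast_atTop_atTop).congr fun N => ?_
    rw [Function.comp_apply, inv_mul_eq_div, Nat.floor_div_eq_div]
  simpa [Function.comp_def] using ((RCLike.continuous_ofReal (K := 𝕜)).tendsto _).comp h_real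

lemma norm_natCast_div_div_le (N d : ℕ) : ‖((N / d : ℕ) : 𝕜) / N‖ ≤ ‖(d : 𝕜)⁻¹‖ := by
  simp only [norm_div, norm_inv, RCLike.norm_natCast]
  calc ((N / d : ℕ) : ℝ) / N ≤ N / d / N := by gcongr; exact Nat.cast_div_le
    _ = N / N * (d : ℝ)⁻¹ := by ring
    _ ≤ (d : ℝ)⁻¹ := mul_le_of_le_one_left (by positivity) (div_self_le_one _)

/-- The arithmetic function `n ↦ (g * μ)(n) / n`, whose sum is the mean value of `g` by Wintner's
theorem. -/
noncomputable def wintnerCoeff (g : ArithmeticFunction 𝕜) : ArithmeticFunction 𝕜 :=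
  (g * (μ : ArithmeticFunction 𝕜)).pdiv (ArithmeticFunction.id : ArithmeticFunction 𝕜)

lemma wintnerCoeff_apply (g : ArithmeticFunction 𝕜) (n : ℕ) :
    wintnerCoeff g n = (g * (μ : ArithmeticFunction 𝕜)) n / n := by
  simp [wintnerCoeff]

lemma isMultiplicative_wintnerCoeff {g : ArithmeticFunction 𝕜} (hg : g.IsMultiplicative) :
    (wintnerCoeff g).IsMultiplicative :=
  (hg.mul ArithmeticFunction.isMultiplicative_moebius.intCast).pdiv
    ArithmeticFunction.isMultiplicative_id.natCast

lemma mul_moebius_mul_zeta (g : ArithmeticFunction 𝕜) :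
    g * (μ : ArithmeticFunction 𝕜) * (ζ : ArithmeticFunction 𝕜) = g := by
  rw [mul_assoc, ArithmeticFunction.coe_moebius_mul_coe_zeta, mul_one]

lemma mul_moebius_apply_prime_pow_succ (g : ArithmeticFunction 𝕜) {p : ℕ} (hp : p.Prime)
    (k : ℕ) :
    (g * (μ : ArithmeticFunction 𝕜)) (p ^ (k + 1)) = g (p ^ (k + 1)) - g (p ^ k) := by
  have h_sum (j : ℕ) :
      g (p ^ j) = ∑ i ∈ Finset.range (j + 1), (g * (μ : ArithmeticFunction 𝕜)) (p ^ i) := by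
    rw [← Nat.sum_divisors_prime_pow hp, ← ArithmeticFunction.coe_mul_zeta_apply,
      mul_moebius_mul_zeta]
  rw [h_sum, h_sum, Finset.sum_range_succ _ (k + 1), add_sub_cancel_left]

lemma norm_wintnerCoeff_prime_pow_succ (g : ArithmeticFunction 𝕜) {p : ℕ} (hp : p.Prime)
    (k : ℕ) : ‖wintnerCoeff g (p ^ (k + 1))‖ = ‖g (p ^ (k + 1)) - g (p ^ k)‖ / p ^ (k + 1) := by
  rw [wintnerCoeff_apply, mul_moebius_apply_prime_pow_succ g hp, norm_div, RCLike.norm_natCast,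
    Nat.cast_pow]

lemma average_eq_tsum_mul_moebius (g : ArithmeticFunction 𝕜) (N : ℕ) :
    (N : 𝕜)⁻¹ * ∑ n ∈ Finset.Icc 1 N, g n =
      ∑' d : ℕ, (g * (μ : ArithmeticFunction 𝕜)) d * (((N / d : ℕ) : 𝕜) / N) := by
  have h_sum : ∑ n ∈ Finset.Icc 1 N, g n =
      ∑ d ∈ Finset.Ioc 0 N, (g * (μ : ArithmeticFunction 𝕜)) d * ((N / d : ℕ) : 𝕜) := by
    rw [← ArithmeticFunction.sum_Ioc_mul_zeta_eq_sum, mul_moebius_mul_zeta]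
    rfl
  rw [h_sum, Finset.mul_sum, tsum_eq_sum fun d hd => ?_]
  · exact Finset.sum_congr rfl fun d _ => by ring
  · rcases d.eq_zero_or_pos with rfl | hpos
    · rw [ArithmeticFunction.map_zero, zero_mul]
    · have hlt : N < d := by simpa [hpos] using hd
      rw [Nat.div_eq_of_lt hlt, Nat.cast_zero, zero_div, mul_zero]

lemma tendsto_average_of_summable_wintnerCoeff {g : ArithmeticFunction 𝕜}
    (hsum : Summable fun n => ‖wintnerCoeff g n‖) :
    Tendsto (fun N : ℕ => (N : 𝕜)⁻¹ * ∑ n ∈ Finset.Icc 1 N, g n) atTop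
      (𝓝 (∑' d, wintnerCoeff g d)) := by
  simp only [average_eq_tsum_mul_moebius]
  refine tendsto_tsum_of_dominated_convergence hsum (fun d => ?_) (.of_forall fun N d => ?_)
  · rw [wintnerCoeff_apply, div_eq_mul_inv]
    exact (tendsto_natCast_div_div_atTop d).const_mul _
  · rw [wintnerCoeff_apply, div_eq_mul_inv _ (d : 𝕜), norm_mul, norm_mul]
    gcongr
    exact norm_natCast_div_div_le N d

lemma tsum_wintnerCoeff_prime_pow {g : ArithmeticFunction 𝕜} {p : ℕ} (hp : p.Prime)
    (hsum : Summable fun k : ℕ => ‖wintnerCoeff g (p ^ k)‖) :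
    ∑' k : ℕ, wintnerCoeff g (p ^ k) = (1 - 1 / (p : 𝕜)) * ∑' k : ℕ, g (p ^ k) / (p : 𝕜) ^ k := by
  have h_ratio : ‖(p : 𝕜)⁻¹‖ < 1 := by
    rw [norm_inv, RCLike.norm_natCast]
    exact inv_lt_one_of_one_lt₀ (Nat.one_lt_cast.2 hp.one_lt)
  -- Since `g = (g * μ) * ζ`, the series of `g` is a Cauchy product with a geometric series.
  have h_term (k : ℕ) : g (p ^ k) / (p : 𝕜) ^ k =
      ∑ i ∈ Finset.range (k + 1), wintnerCoeff g (p ^ i) * (p : 𝕜)⁻¹ ^ (k - i) := by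
    rw [← mul_moebius_mul_zeta g, ArithmeticFunction.coe_mul_zeta_apply,
      Nat.sum_divisors_prime_pow hp, Finset.sum_div, mul_moebius_mul_zeta]
    refine Finset.sum_congr rfl fun i hi => ?_
    rw [wintnerCoeff_apply, Nat.cast_pow, inv_pow, ← div_eq_mul_inv, div_div, ← pow_add,
      Nat.add_sub_cancel' (Finset.mem_range_succ_iff.1 hi)]
  have h_cauchy : ∑' k : ℕ, g (p ^ k) / (p : 𝕜) ^ k =
      (∑' k : ℕ, wintnerCoeff g (p ^ k)) * ∑' k : ℕ, (p : 𝕜)⁻¹ ^ k := by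
    simp_rw [h_term]
    exact (tsum_mul_tsum_eq_tsum_sum_range_of_summable_norm hsum
      (summable_norm_geometric_of_norm_lt_one h_ratio)).symm
  have h_ne : 1 - (p : 𝕜)⁻¹ ≠ 0 :=
    sub_ne_zero.2 fun h => h_ratio.ne (by rw [← h, norm_one])
  rw [h_cauchy, tsum_geometric_of_norm_lt_one h_ratio, one_div, mul_left_comm,
    mul_inv_cancel₀ h_ne, mul_one]

lemma hasProd_tsum_wintnerCoeff {g : ArithmeticFunction 𝕜} (hg : g.IsMultiplicative)
    (hsum : Summable fun n => ‖wintnerCoeff g n‖) :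
    HasProd (fun p : Nat.Primes => (1 - 1 / (p : 𝕜)) * ∑' k : ℕ, g (p ^ k) / (p : 𝕜) ^ k)
      (∑' n, wintnerCoeff g n) := by
  have h_local (p : Nat.Primes) : ∑' k : ℕ, wintnerCoeff g (p ^ k) =
      (1 - 1 / (p : 𝕜)) * ∑' k : ℕ, g (p ^ k) / (p : 𝕜) ^ k :=
    tsum_wintnerCoeff_prime_pow p.2 (hsum.comp_injective (Nat.pow_right_injective p.2.two_le))
  simpa only [h_local] using (isMultiplicative_wintnerCoeff hg).eulerProduct_hasProd hsum

end MeanValue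

section ExpTwist

lemma norm_expTwist (f : ArithmeticFunction ℝ) (t : ℝ) (n : ℕ) : ‖expTwist f t n‖ = 1 := by
  rw [expTwist, mul_assoc, ← Complex.ofReal_mul, Complex.norm_exp_I_mul_ofReal]

lemma expTwist_add (f : ArithmeticFunction ℝ) (s t : ℝ) (n : ℕ) :
    expTwist f (s + t) n = expTwist f s n * expTwist f t n := by
  rw [expTwist, expTwist, expTwist, ← Complex.exp_add]
  push_cast
  ring_nf

lemma expTwist_neg (f : ArithmeticFunction ℝ) (t : ℝ) (n : ℕ) :
    expTwist f (-t) n = starRingEnd ℂ (expTwist f t n) := by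
  simp [expTwist, ← Complex.exp_conj]

lemma norm_expTwist_add_sub_le (f : ArithmeticFunction ℝ) (s t : ℝ) (m n : ℕ) :
    ‖expTwist f (s + t) m - expTwist f (s + t) n‖ ≤
      ‖expTwist f s m - expTwist f s n‖ + ‖expTwist f t m - expTwist f t n‖ := by
  calc ‖expTwist f (s + t) m - expTwist f (s + t) n‖
      = ‖(expTwist f s m - expTwist f s n) * expTwist f t m +
          expTwist f s n * (expTwist f t m - expTwist f t n)‖ := by
        rw [expTwist_add, expTwist_add]
        ring_nf
    _ ≤ ‖expTwist f s m - expTwist f s n‖ + ‖expTwist f t m - expTwist f t n‖ := by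
        refine (norm_add_le _ _).trans_eq ?_
        rw [norm_mul, norm_mul, norm_expTwist, norm_expTwist, mul_one, one_mul]

/-- The term of the summability condition at the prime power `p ^ (k + 1)`, as a function of `t`:
it is a group seminorm because `t ↦ e^{itf(n)}` is a unitary character. -/
noncomputable def primePowerSeminorm (f : ArithmeticFunction ℝ) (x : Nat.Primes × ℕ) :
    AddGroupSeminorm ℝ where
  toFun t := ‖expTwist f t (x.1 ^ (x.2 + 1)) - expTwist f t (x.1 ^ x.2)‖ / (x.1 : ℝ) ^ (x.2 + 1)
  map_zero' := by simp [expTwist]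
  add_le' s t := by
    rw [← add_div]
    gcongr
    exact norm_expTwist_add_sub_le f s t _ _
  neg' t := by rw [expTwist_neg, expTwist_neg, ← map_sub, RCLike.norm_conj]

lemma continuous_primePowerSeminorm (f : ArithmeticFunction ℝ) (x : Nat.Primes × ℕ) :
    Continuous (primePowerSeminorm f x) := by
  change Continuous fun t : ℝ =>
    ‖expTwist f t (x.1 ^ (x.2 + 1)) - expTwist f t (x.1 ^ x.2)‖ / (x.1 : ℝ) ^ (x.2 + 1)
  unfold expTwist
  fun_prop

/-- The function `n ↦ e^{itf(n)}`, set to `0` at `n = 0` to make it an arithmetic function. -/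
noncomputable def arithTwist (f : ArithmeticFunction ℝ) (t : ℝ) : ArithmeticFunction ℂ where
  toFun n := if n = 0 then 0 else expTwist f t n
  map_zero' := if_pos rfl

lemma arithTwist_apply (f : ArithmeticFunction ℝ) (t : ℝ) {n : ℕ} (hn : n ≠ 0) :
    arithTwist f t n = expTwist f t n :=
  if_neg hn

lemma norm_wintnerCoeff_arithTwist_prime_pow_succ (f : ArithmeticFunction ℝ) (t : ℝ)
    (x : Nat.Primes × ℕ) :
    ‖wintnerCoeff (arithTwist f t) (x.1 ^ (x.2 + 1))‖ = primePowerSeminorm f x t := by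
  rw [norm_wintnerCoeff_prime_pow_succ _ x.1.2, arithTwist_apply f t (pow_ne_zero _ x.1.2.ne_zero),
    arithTwist_apply f t (pow_ne_zero _ x.1.2.ne_zero)]
  rfl

variable {f : ArithmeticFunction ℝ}

lemma isMultiplicative_arithTwist (hf : IsAdditiveArith f) (t : ℝ) :
    (arithTwist f t).IsMultiplicative := by
  refine ArithmeticFunction.IsMultiplicative.iff_ne_zero.2 ⟨?_, fun {m n} hm hn hmn => ?_⟩
  · simp [arithTwist_apply, expTwist, hf.1]
  · rw [arithTwist_apply f t (mul_ne_zero hm hn), arithTwist_apply f t hm, arithTwist_apply f t hn,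
      expTwist, expTwist, expTwist, hf.2 m n hmn, ← Complex.exp_add, Complex.ofReal_add, mul_add]

lemma summable_norm_wintnerCoeff_arithTwist (hf : IsAdditiveArith f) {t : ℝ}
    (hsum : Summable fun x => primePowerSeminorm f x t) :
    Summable fun n => ‖wintnerCoeff (arithTwist f t) n‖ := by
  refine summable_norm_of_summable_norm_prime_pow
    (isMultiplicative_wintnerCoeff (isMultiplicative_arithTwist hf t)) ?_
  simpa only [norm_wintnerCoeff_arithTwist_prime_pow_succ] using hsum

lemma tendsto_average_expTwist (hf : IsAdditiveArith f) {t : ℝ}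
    (hsum : Summable fun x => primePowerSeminorm f x t) :
    Tendsto (fun n : ℕ => (n : ℂ)⁻¹ * ∑ m ∈ Finset.Icc 1 n, expTwist f t m) atTop
      (𝓝 (∑' n, wintnerCoeff (arithTwist f t) n)) := by
  refine (tendsto_average_of_summable_wintnerCoeff
    (summable_norm_wintnerCoeff_arithTwist hf hsum)).congr fun n => ?_
  congr 1
  exact Finset.sum_congr rfl fun m hm =>
    arithTwist_apply f t (Nat.one_le_iff_ne_zero.1 (Finset.mem_Icc.1 hm).1)

lemma hasProd_localFactor (hf : IsAdditiveArith f) {t : ℝ}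
    (hsum : Summable fun x => primePowerSeminorm f x t) :
    HasProd (fun p : Nat.Primes => localFactor f t p)
      (∑' n, wintnerCoeff (arithTwist f t) n) := by
  have h_factor (p : Nat.Primes) : localFactor f t p =
      (1 - 1 / (p : ℂ)) * ∑' k : ℕ, arithTwist f t (p ^ k) / (p : ℂ) ^ k := by
    simp only [localFactor, arithTwist_apply f t (pow_ne_zero _ p.2.ne_zero)]
  simp only [h_factor]
  exact hasProd_tsum_wintnerCoeff (isMultiplicative_arithTwist hf t)
    (summable_norm_wintnerCoeff_arithTwist hf hsum)

lemma continuousAt_tsum_wintnerCoeff_arithTwist (hf : IsAdditiveArith f)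
    (hsum : ∀ t, Summable fun x => primePowerSeminorm f x t) :
    ContinuousAt (fun t => ∑' n, wintnerCoeff (arithTwist f t) n) 0 := by
  have h_le (t : ℝ) : ‖∑' n, wintnerCoeff (arithTwist f t) n - 1‖ ≤
      Real.exp (∑' x, primePowerSeminorm f x t) - 1 := by
    simp only [← norm_wintnerCoeff_arithTwist_prime_pow_succ] at hsum ⊢
    exact norm_tsum_sub_one_le
      (isMultiplicative_wintnerCoeff (isMultiplicative_arithTwist hf t)) (hsum t)
  have h_exp : Tendsto (fun t => Real.exp (∑' x, primePowerSeminorm f x t) - 1) (𝓝 0) (𝓝 0) := by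
    simpa only [Real.exp_zero, sub_self] using ((tendsto_tsum_addGroupSeminorm_nhds_zero
      (continuous_primePowerSeminorm f) hsum).rexp).sub_const 1
  exact continuousAt_of_tendsto_nhds (tendsto_iff_norm_sub_tendsto_zero.2
    (squeeze_zero (fun _ => norm_nonneg _) h_le h_exp))

end ExpTwist

/- The pair `(p, k)` of the summability condition stands for the prime power `p ^ (k + 1)`. -/
theorem mainTheorem2 (f : ArithmeticFunction ℝ) (hf : IsAdditiveArith f)
    (hsum : ∀ t : ℝ, Summable (fun x : Nat.Primes × ℕ =>
      ‖expTwist f t ((x.1 : ℕ) ^ (x.2 + 1)) - expTwist f t ((x.1 : ℕ) ^ x.2)‖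
        / ((x.1 : ℕ) : ℝ) ^ (x.2 + 1))) :
    ∃ μ : Measure ℝ, HasLimitDistribution f μ ∧
      ∀ t : ℝ, HasProd (fun p : Nat.Primes => localFactor f t (p : ℕ)) (charFun μ t) := by
  obtain ⟨μ, hμ, h_charFun⟩ := exists_hasLimitDistribution
    (continuousAt_tsum_wintnerCoeff_arithTwist hf hsum)
    fun t => tendsto_average_expTwist hf (hsum t)
  refine ⟨μ, hμ, fun t => ?_⟩
  rw [h_charFun]
  exact hasProd_localFactor hf (hsum t)
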